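/- Let $R$ be a complete, separated topological associative ring with unit in which open right ideals form a base of neighborhoods of zero. Let $H\subset R$ be a two-sided ideal such that: 1. $H$ is strongly closed: $H$ is closed in $R$, the quotient group $R/H$ is complete in the quotient topology, and for every set $X$ every $X$-indexed family of elements of $R/H$ converging to zero lifts to an $X$-indexed family of elements of $R$ converging to zero (a family in a topological abelian group converges to zero if every neighborhood of zero contains all but finitely many of its members); 2. $H$ is topologically left T-nilpotent: for every sequence $a_1,a_2,a_3,\dots$ of elements of $H$, the sequence of products $a_1,\ a_1a_2,\ a_1a_2a_3,\ \dots$ converges to zero in $R$; 3. the quotient ring $R/H$, with the quotient topology, is isomorphic as a topological ring to a product $\prod_{\gamma\in\Gamma}S_\gamma$, with the product topology, of some family of simple Artinian rings $S_\gamma$ viewed as discrete topological rings. Then every left $R$-contramodule has a projective cover. Here, for a set $X$, $R[[X]]$ denotes the set of all formal linear combinations $\sum_{x\in X}r_x x$ whose family of coefficients $(r_x)_{x\in X}$ in $R$ converges to zero. The assignment $X\mapsto R[[X]]$ is a monad on the category of sets: a map $f\colon X\to Y$ induces $\sum_x r_x x\mapsto\sum_{y}\bigl(\sum_{f(x)=y}r_x\bigr)y$,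 the unit $X\to R[[X]]$ sends $x$ to $1\cdot x$, and the multiplication $R[[R[[X]]]]\to R[[X]]$ opens the parentheses, $\sum_{y} r_y\, y\mapsto\sum_{x}\bigl(\sum_{y} r_y s_{y,x}\bigr)x$ for $y=\sum_x s_{y,x}x\in R[[X]]$, the infinite sums being limits of finite partial sums in $R$. A left $R$-contramodule is an algebra over this monad. A projective cover of an object $C$ of an abelian category with enough projective objects (here, the category of left $R$-contramodules) is an epimorphism $p\colon P\to C$ with $P$ projective such that every endomorphism $e\colon P\to P$ with $pe=p$ is an automorphism. -/

import Mathlib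

open Filter Topology CategoryTheory

universe u v w

/-! ### Families converging to zero -/

section ConvFam

set_option linter.unusedSectionVars false

variable (R : Type u) [Ring R] [UniformSpace R]

/-- `R[[X]]`: the set of all `X`-indexed families `(r_x)` of elements of `R` which converge to zero
in the topology of `R` (all but finitely many `r_x` lie in any given neighbourhood of zero),
interpreted as convergent formal linear combinations `∑ r_x x`. -/
def ConvFam (X : Type v) : Type (max u v) :=
  {a : X → R // Tendsto a cofinite (𝓝 0)}

namespace ConvFam

variable {R} {X : Type v} {Y : Type w}

instance : CoeFun (ConvFam R X) (fun _ => X → R) := ⟨Subtype.val⟩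

@[ext]
theorem ext {a b : ConvFam R X} (h : ∀ x, a x = b x) : a = b := Subtype.ext (funext h)

variable [IsUniformAddGroup R] [IsTopologicalRing R] [IsLinearTopology Rᵐᵒᵖ R]

/-- A ring whose open right ideals form a base at zero is non-archimedean. -/
theorem nonarchimedean : NonarchimedeanAddGroup R where
  is_nonarchimedean U hU := by
    obtain ⟨I, hI, hIU⟩ :=
      (IsLinearTopology.hasBasis_open_submodule (R := Rᵐᵒᵖ) (M := R)).mem_iff.1 hU
    exact ⟨⟨I.toAddSubgroup, hI⟩, hIU⟩

theorem summable [CompleteSpace R] {f : X → R} (hf : Tendsto f cofinite (𝓝 0)) : Summable f :=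
  haveI := nonarchimedean (R := R)
  NonarchimedeanAddGroup.summable_of_tendsto_cofinite_zero hf

theorem tendsto_mul_right {a : X → R} (ha : Tendsto a cofinite (𝓝 0)) (b : X → R) :
    Tendsto (fun x => a x * b x) cofinite (𝓝 0) :=
  IsLinearTopology.tendsto_mul_zero_of_left a b ha

/-- If `a x → 0`, and `g x y → 0` in `y` for every `x`, then `a x * g x y → 0` in `(x, y)`. -/
theorem tendsto_prod {a : X → R} (ha : Tendsto a cofinite (𝓝 0)) {g : X → Y → R}
    (hg : ∀ x, Tendsto (g x) cofinite (𝓝 0)) :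
    Tendsto (fun p : X × Y => a p.1 * g p.1 p.2) cofinite (𝓝 0) := by
  rw [(IsLinearTopology.hasBasis_submodule (R := Rᵐᵒᵖ) (M := R)).tendsto_right_iff]
  intro I hI
  have hF : {x | ¬ a x ∈ I}.Finite := ha hI
  have hx : ∀ x, {y | ¬ a x * g x y ∈ I}.Finite := fun x => by
    have h : Tendsto (fun y => a x * g x y) cofinite (𝓝 0) := by
      simpa using (hg x).const_mul (a x)
    exact h hI
  refine Set.Finite.subset (hF.biUnion fun x _ => (hx x).image (fun y => (x, y))) ?_
  rintro ⟨x, y⟩ hxy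
  have hxy' : ¬ a x * g x y ∈ I := hxy
  simp only [Set.mem_iUnion]
  exact ⟨x, fun h => hxy' (I.smul_mem (MulOpposite.op (g x y)) h), y, hxy', rfl⟩

/-- If `f (x, y) → 0` in `(x, y)`, then the sums over `x` converge to zero in `y`. -/
theorem tendsto_tsum {f : X × Y → R} (hf : Tendsto f cofinite (𝓝 0)) :
    Tendsto (fun y => ∑' x, f (x, y)) cofinite (𝓝 0) := by
  rw [(IsLinearTopology.hasBasis_open_submodule (R := Rᵐᵒᵖ) (M := R)).tendsto_right_iff]
  intro I hI
  have hF : {p | ¬ f p ∈ I}.Finite := hf (hI.mem_nhds I.zero_mem)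
  refine Set.Finite.subset (hF.image Prod.snd) ?_
  intro y hy
  by_contra hcon
  have hcl : IsClosed (I : Set R) := AddSubgroup.isClosed_of_isOpen I.toAddSubgroup hI
  refine hy (tsum_mem hcl fun x => ?_)
  by_contra hx
  exact hcon ⟨(x, y), hx, rfl⟩

/-- The substitution of convergent formal linear combinations `g x = ∑_y g_{x,y} y` into
`∑_x a_x x`; the coefficient at `y` is `∑_x a_x g_{x,y}`. -/
noncomputable def subst (a : ConvFam R X) (g : X → ConvFam R Y) : ConvFam R Y :=
  ⟨fun y => ∑' x, a x * g x y, tendsto_tsum (tendsto_prod a.2 fun x => (g x).2)⟩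

open Classical in
/-- The point measure `1 · x₀`. -/
noncomputable def point (x₀ : X) : ConvFam R X :=
  ⟨fun x => if x = x₀ then 1 else 0, by
    refine tendsto_nhds.2 fun U _ h0 => Set.Finite.subset (Set.finite_singleton x₀) fun x hx => ?_
    by_contra hne
    exact hx (by simpa [show x ≠ x₀ from hne] using h0)⟩

theorem tsum_fiber (a : X → R) (f : X → Y) (y : Y) :
    ∑' x : f ⁻¹' {y}, a x = ∑' x, a x * (point (R := R) (f x) : ConvFam R Y) y := by
  classical
  rw [tsum_subtype (f ⁻¹' {y}) a]
  refine tsum_congr fun x => ?_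
  simp [point, Set.indicator_apply, eq_comm]

/-- The map `R[[f]] : R[[X]] → R[[Y]]`, `∑_x a_x x ↦ ∑_y (∑_{f x = y} a_x) y`. -/
noncomputable def map (f : X → Y) (a : ConvFam R X) : ConvFam R Y :=
  ⟨fun y => ∑' x : f ⁻¹' {y}, a x, by
    simp only [tsum_fiber]
    exact (subst a fun x => point (f x)).2⟩

/-- Opening of parentheses `R[[R[[X]]]] → R[[X]]`: the coefficient of the result at `x` is
`∑_y r_y y_x`, where `y` ranges over `R[[X]]`. -/
noncomputable def join (r : ConvFam R (ConvFam R X)) : ConvFam R X :=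
  ⟨fun x => ∑' y : ConvFam R X, r y * y x, (subst r fun y => y).2⟩

theorem map_eq_subst (f : X → Y) (a : ConvFam R X) : map f a = subst a fun x => point (f x) :=
  ext fun y => tsum_fiber a f y

theorem join_eq_subst (r : ConvFam R (ConvFam R X)) : join r = subst r fun y => y := rfl

theorem subst_point (a : ConvFam R X) : subst a point = a := by
  classical
  refine ext fun x => ?_
  change ∑' z, a z * (if x = z then 1 else 0) = a x
  rw [tsum_eq_single x (fun z hz => by simp [hz.symm])]
  simp

theorem point_subst (x : X) (g : X → ConvFam R Y) : subst (point x) g = g x := by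
  classical
  refine ext fun y => ?_
  change ∑' z, (if z = x then 1 else 0) * g z y = g x y
  rw [tsum_eq_single x (fun z hz => by simp [hz])]
  simp

theorem subst_assoc [CompleteSpace R] [T2Space R] {Z : Type*} (a : ConvFam R X)
    (g : X → ConvFam R Y) (h : Y → ConvFam R Z) :
    subst (subst a g) h = subst a fun x => subst (g x) h := by
  refine ext fun z => ?_
  change ∑' y, (∑' x, a x * g x y) * h y z = ∑' x, a x * ∑' y, g x y * h y z
  have hgh : ∀ x, Tendsto (fun y => g x y * h y z) cofinite (𝓝 0) := fun x =>
    tendsto_mul_right (g x).2 _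
  have key : Summable (Function.uncurry fun x y => a x * (g x y * h y z)) :=
    summable (tendsto_prod a.2 hgh)
  calc ∑' y, (∑' x, a x * g x y) * h y z
      = ∑' y, ∑' x, a x * (g x y * h y z) := tsum_congr fun y => by
        rw [← (summable (tendsto_mul_right a.2 fun x => g x y)).tsum_mul_right]
        simp only [mul_assoc]
    _ = ∑' x, ∑' y, a x * (g x y * h y z) := key.tsum_comm
    _ = _ := tsum_congr fun x => (summable (hgh x)).tsum_mul_left _

end ConvFam

end ConvFam

/-! ### Contramodules -/

section Contramodule

variable (R : Type u) [Ring R] [UniformSpace R] [IsUniformAddGroup R] [IsTopologicalRing R]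
  [IsLinearTopology Rᵐᵒᵖ R] [CompleteSpace R] [T2Space R]

open ConvFam in
/-- The monad `X ↦ R[[X]]` on the category of sets, for a complete, separated topological ring `R`
with a base of neighbourhoods of zero formed by open right ideals. -/
noncomputable def contraMonad : Monad (Type u) where
  obj X := ConvFam R X
  map f := TypeCat.ofHom (ConvFam.map f)
  map_id X := by
    ext a : 3
    exact (map_eq_subst _ _).trans (subst_point a)
  map_comp f g := by
    ext a : 3
    change ConvFam.map (g ∘ f) a = ConvFam.map g (ConvFam.map f a)
    simp only [map_eq_subst, subst_assoc, point_subst, Function.comp]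
  η :=
    { app X := TypeCat.ofHom point
      naturality X Y f := by
        ext x : 3
        change point (f x) = ConvFam.map f (point x)
        rw [map_eq_subst, point_subst] }
  μ :=
    { app X := TypeCat.ofHom join
      naturality X Y f := by
        ext r : 3
        change join (ConvFam.map (ConvFam.map f) r) = ConvFam.map f (join r)
        simp only [join_eq_subst, map_eq_subst, subst_assoc, point_subst] }
  assoc X := by
    ext r : 3
    change join (ConvFam.map join r) = join (join r)
    simp only [join_eq_subst, map_eq_subst, subst_assoc, point_subst]
  left_unit X := by
    ext a : 3
    change join (point a) = a
    rw [join_eq_subst, point_subst]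
  right_unit X := by
    ext a : 3
    change join (ConvFam.map point a) = a
    simp only [join_eq_subst, map_eq_subst, subst_assoc, point_subst, subst_point]

/-- The category of left `R`-contramodules: algebras over the monad `X ↦ R[[X]]`. -/
abbrev Contramodule : Type (u + 1) := (contraMonad R).Algebra

end Contramodule

/-! ### Projective covers -/

/-- An epimorphism `p : P ⟶ C` is a projective cover of `C` if `P` is projective and every
endomorphism `e` of `P` with `p ∘ e = p` is an automorphism. -/
structure IsProjectiveCover {B : Type u} [Category.{v} B] {P C : B} (p : P ⟶ C) : Prop where
  epi : Epi p
  projective : Projective P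
  isIso_of_comp_eq : ∀ e : P ⟶ P, e ≫ p = p → IsIso e

/-! ### Strongly closed and T-nilpotent ideals -/

/-- A subgroup `H` of a (complete, separated) topological abelian group `A` is strongly closed if it
is closed, the quotient group `A ⧸ H` is complete in the quotient topology, and for every set `X`
the map `A[[X]] → (A ⧸ H)[[X]]` is surjective, i.e. every family in `A ⧸ H` converging to zero lifts
to a family in `A` converging to zero. -/
structure IsStronglyClosed {A : Type u} [AddCommGroup A] [TopologicalSpace A]
    [IsTopologicalAddGroup A] (H : AddSubgroup A) : Prop where
  isClosed : IsClosed (H : Set A)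
  complete : @CompleteSpace (A ⧸ H) (IsTopologicalAddGroup.rightUniformSpace (A ⧸ H))
  lift : ∀ (X : Type u) (b : X → A ⧸ H), Tendsto b cofinite (𝓝 0) →
    ∃ a : X → A, Tendsto a cofinite (𝓝 0) ∧ ∀ x, (QuotientAddGroup.mk (a x) : A ⧸ H) = b x

/-- `H` is topologically left T-nilpotent: for every sequence `a₀, a₁, a₂, …` in `H`, the sequence
of products `a₀, a₀ a₁, a₀ a₁ a₂, …` converges to zero. -/
def IsTopLeftTNilpotent {R : Type u} [Ring R] [TopologicalSpace R] (H : Ideal R) : Prop :=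
  ∀ a : ℕ → R, (∀ n, a n ∈ H) →
    Tendsto (fun n : ℕ => ((List.range (n + 1)).map a).prod) atTop (𝓝 0)

/-! ### Linear structure on convergent families -/

/-! Let `D` be the quotient of `C` by all infinite combinations with coefficients in `H`. Only the
images of coefficients in the rings `S γ` matter for `D`. Lifts `u γ` of the central idempotents
split `D` into components, and every element is recovered from its components by a convergent sum
(`ev_unit_smul`). Each component is a semisimple module over `S γ`, hence a direct sum of cyclic
modules. Each generator has, modulo `H`, the annihilator of an idempotent, and idempotents lift to
`R` because `H` is T-nilpotent. So `D` is the reduction of a projective contramodule `P`, the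
coproduct of contramodules `R e_x` (`exists_basis`). Lifting the generators of `D` to `C` gives `p :
P ⟶ C`.

The rest is matrix algebra over `H`. By König's lemma the powers of a matrix over `H` tend to zero,
so a Neumann series inverts every matrix congruent to the identity modulo `H` (`subst_bijective`).
This gives Nakayama's lemma, hence surjectivity of `p`. It also gives minimality: an endomorphism
`f` of `P` with `f ≫ p = p` is the identity modulo `H`, hence bijective. -/

namespace ConvFam

section Linear

set_option linter.unusedSectionVars false

variable {R : Type u} [Ring R] [UniformSpace R] [IsUniformAddGroup R] [IsTopologicalRing R]
variable {X : Type v} {Y : Type w}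

variable (R X) in
/-- The families converging to zero, as a submodule of the module of all families. -/
def submodule : Submodule R (X → R) where
  carrier := {a | Tendsto a cofinite (𝓝 0)}
  add_mem' ha hb := by
    have h := Tendsto.add ha hb
    rw [add_zero] at h
    exact h
  zero_mem' := tendsto_const_nhds
  smul_mem' r a ha := by
    have h := Tendsto.const_mul r ha
    rw [mul_zero] at h
    exact h

noncomputable instance : AddCommGroup (ConvFam R X) :=
  inferInstanceAs (AddCommGroup (submodule R X))

noncomputable instance : Module R (ConvFam R X) :=
  inferInstanceAs (Module R (submodule R X))

@[simp] theorem add_apply (a b : ConvFam R X) (x : X) : (a + b) x = a x + b x := rfl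
@[simp] theorem sub_apply (a b : ConvFam R X) (x : X) : (a - b) x = a x - b x := rfl
@[simp] theorem neg_apply (a : ConvFam R X) (x : X) : (-a) x = -a x := rfl
@[simp] theorem zero_apply (x : X) : (0 : ConvFam R X) x = 0 := rfl
@[simp] theorem smul_apply (r : R) (a : ConvFam R X) (x : X) : (r • a) x = r * a x := rfl

/-- Evaluation at an index, as a linear map. -/
noncomputable def coeff (x : X) : ConvFam R X →ₗ[R] R where
  toFun a := a x
  map_add' _ _ := rfl
  map_smul' _ _ := rfl

theorem sum_apply {ι : Type*} (s : Finset ι) (a : ι → ConvFam R X) (x : X) :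
    (∑ i ∈ s, a i) x = ∑ i ∈ s, a i x :=
  map_sum (coeff x) a s

variable [IsLinearTopology Rᵐᵒᵖ R]

open Classical in
theorem point_apply (x y : X) : (point x : ConvFam R X) y = if y = x then 1 else 0 := rfl

theorem point_apply_self (x : X) : (point x : ConvFam R X) x = 1 := by
  simp [point]

theorem point_apply_of_ne {x y : X} (h : y ≠ x) : (point x : ConvFam R X) y = 0 := by
  simp [point, h]

theorem subst_apply (a : ConvFam R X) (g : X → ConvFam R Y) (y : Y) :
    subst a g y = ∑' x, a x * g x y := rfl

variable [CompleteSpace R] [T2Space R]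

theorem summable_mul (a : ConvFam R X) (b : X → R) : Summable fun x => a x * b x :=
  summable (tendsto_mul_right a.2 b)

theorem add_subst (a b : ConvFam R X) (g : X → ConvFam R Y) :
    subst (a + b) g = subst a g + subst b g := by
  ext y
  simp only [subst_apply, add_apply, add_mul]
  exact (summable_mul a _).tsum_add (summable_mul b _)

theorem smul_subst (r : R) (a : ConvFam R X) (g : X → ConvFam R Y) :
    subst (r • a) g = r • subst a g := by
  ext y
  simp only [subst_apply, smul_apply, mul_assoc]
  exact (summable_mul a _).tsum_mul_left r

/-- Substitution of a fixed matrix, as a linear map. -/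
noncomputable def substₗ (g : X → ConvFam R Y) : ConvFam R X →ₗ[R] ConvFam R Y where
  toFun a := subst a g
  map_add' a b := add_subst a b g
  map_smul' r a := smul_subst r a g

theorem sub_subst (a b : ConvFam R X) (g : X → ConvFam R Y) :
    subst (a - b) g = subst a g - subst b g :=
  map_sub (substₗ g) a b

theorem subst_add (a : ConvFam R X) (g h : X → ConvFam R Y) :
    subst a (fun x => g x + h x) = subst a g + subst a h := by
  ext y
  simp only [subst_apply, add_apply, mul_add]
  exact (summable_mul a _).tsum_add (summable_mul a _)

theorem subst_sub (a : ConvFam R X) (g h : X → ConvFam R Y) :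
    subst a (fun x => g x - h x) = subst a g - subst a h := by
  rw [eq_sub_iff_add_eq, ← subst_add]
  simp

theorem subst_smul_point (a : ConvFam R X) (r : X → R) (x : X) :
    subst a (fun x => r x • point x) x = a x * r x := by
  rw [subst_apply, tsum_eq_single x fun z hz => ?_]
  · simp [point_apply_self]
  · simp [point_apply_of_ne hz.symm]

end Linear

/-! ### Matrices over a topologically T-nilpotent ideal -/

section Nilpotent

set_option linter.unusedSectionVars false

variable {R : Type u} [Ring R] [UniformSpace R] [IsUniformAddGroup R] [IsTopologicalRing R]
  [IsLinearTopology Rᵐᵒᵖ R] {X : Type v} {Y : Type w}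

theorem isClosed_of_isOpen {I : Submodule Rᵐᵒᵖ R} (hI : IsOpen (I : Set R)) :
    IsClosed (I : Set R) :=
  AddSubgroup.isClosed_of_isOpen I.toAddSubgroup hI

theorem subst_apply_mem {I : Submodule Rᵐᵒᵖ R} (hI : IsOpen (I : Set R)) {a : ConvFam R X}
    {g : X → ConvFam R Y} {y : Y} (h : ∀ x, a x * g x y ∈ I) : subst a g y ∈ I :=
  tsum_mem (s := I) (isClosed_of_isOpen hI) h

theorem mul_mem_of_mem {I : Submodule Rᵐᵒᵖ R} {r : R} (hr : r ∈ I) (s : R) : r * s ∈ I :=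
  I.smul_mem (MulOpposite.op s) hr

/-- The powers of a row-convergent square matrix. -/
noncomputable def matPow (φ : X → ConvFam R X) : ℕ → X → ConvFam R X
  | 0 => point
  | n + 1 => fun x => subst (φ x) (matPow φ n)

variable [CompleteSpace R] [T2Space R]

theorem subst_matPow_succ (φ : X → ConvFam R X) (a : ConvFam R X) (n : ℕ) :
    subst a (matPow φ (n + 1)) = subst (subst a φ) (matPow φ n) :=
  (subst_assoc a φ _).symm

theorem subst_matPow_succ' (φ : X → ConvFam R X) (a : ConvFam R X) (n : ℕ) :
    subst a (matPow φ (n + 1)) = subst (subst a (matPow φ n)) φ := by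
  induction n generalizing a with
  | zero => simp [matPow, subst_point]
  | succ n ih => rw [subst_matPow_succ, ih, ← subst_matPow_succ]

variable {H : Ideal R}

/-- A matrix over a topologically left T-nilpotent ideal is topologically nilpotent, locally
uniformly: this is König's lemma for the tree of nonzero partial products modulo `I`. -/
theorem eventually_mul_matPow_mem (hnil : IsTopLeftTNilpotent H) {φ : X → ConvFam R X}
    (hφ : ∀ x y, φ x y ∈ H) {I : Submodule Rᵐᵒᵖ R} (hI : IsOpen (I : Set R)) (r : R) (x : X) :
    ∀ᶠ n in atTop, ∀ y, r * matPow φ n x y ∈ I := by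
  let Q : R × X → Prop := fun p => ∀ᶠ n in atTop, ∀ y, p.1 * matPow φ n p.2 y ∈ I
  have hQI : ∀ p : R × X, p.1 ∈ I → Q p := fun p hp =>
    Eventually.of_forall fun n y => mul_mem_of_mem hp _
  -- Only finitely many `x'` have `r * φ x x'` outside `I`. If all these successors satisfied `Q`, a
  -- common bound on `n` would give `Q (r, x)`.
  have hstep : ∀ p : R × X, ¬ Q p → ∃ x', ¬ Q (p.1 * φ p.2 x', x') := by
    rintro ⟨r, x⟩ hp
    by_contra! hcon
    apply hp
    have hfin : {x' | r * φ x x' ∉ I}.Finite := by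
      have h : Tendsto (fun y => r * φ x y) cofinite (𝓝 0) := by
        simpa using (φ x).2.const_mul r
      exact h (hI.mem_nhds I.zero_mem)
    have hall : ∀ᶠ n in atTop, ∀ x' ∈ {x' | r * φ x x' ∉ I},
        ∀ y, r * φ x x' * matPow φ n x' y ∈ I :=
      (hfin.eventually_all).2 fun x' _ => hcon x'
    change ∀ᶠ n in atTop, ∀ y, r * matPow φ n x y ∈ I
    rw [← Filter.map_add_atTop_eq_nat 1]
    refine Filter.eventually_map.2 (hall.mono fun n hn y => ?_)
    have hsum : r * matPow φ (n + 1) x y = ∑' x', r * φ x x' * matPow φ n x' y := by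
      simp only [mul_assoc]
      exact ((summable_mul (φ x) _).tsum_mul_left r).symm
    rw [hsum]
    refine tsum_mem (s := I) (isClosed_of_isOpen hI) fun x' => ?_
    by_cases hx' : r * φ x x' ∈ I
    · exact mul_mem_of_mem hx' _
    · exact hn x' hx' y
  by_contra hcon
  choose f hf using hstep
  -- An infinite branch of pairs violating `Q`. Its first entries are `r` times partial products of
  -- elements of `H`, so one of them lies in `I`, and then `hQI` applies.
  let p : ℕ → {p : R × X // ¬ Q p} := fun n =>
    Nat.rec ⟨(r, x), hcon⟩ (fun _ q => ⟨(q.1.1 * φ q.1.2 (f q.1 q.2), f q.1 q.2), hf q.1 q.2⟩) n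
  let h : ℕ → R := fun n => φ (p n).1.2 (p (n + 1)).1.2
  have hp : ∀ n, (p n).1.1 = r * ((List.range n).map h).prod := by
    intro n
    induction n with
    | zero => simp [p]
    | succ n ih =>
      rw [List.prod_range_succ, ← mul_assoc, ← ih]
  have hlim : Tendsto (fun n => r * ((List.range (n + 1)).map h).prod) atTop (𝓝 0) := by
    simpa using (hnil h fun n => hφ _ _).const_mul r
  obtain ⟨n, hn⟩ := (hlim.eventually (hI.mem_nhds I.zero_mem)).exists
  have hmem : (p (n + 1)).1.1 ∈ I := (congrArg (· ∈ I) (hp (n + 1))).mpr hn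
  exact (p (n + 1)).2 (hQI _ hmem)

/-- All but finitely many `a x` already lie in the right ideal `I`; the remaining rows share a
common bound on `n`. -/
theorem eventually_subst_matPow_mem (hnil : IsTopLeftTNilpotent H) {φ : X → ConvFam R X}
    (hφ : ∀ x y, φ x y ∈ H) {I : Submodule Rᵐᵒᵖ R} (hI : IsOpen (I : Set R)) (a : ConvFam R X) :
    ∀ᶠ n in atTop, ∀ y, subst a (matPow φ n) y ∈ I := by
  have hfin : {x | a x ∉ I}.Finite := a.2 (hI.mem_nhds I.zero_mem)
  filter_upwards [hfin.eventually_all.2 fun x _ =>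
    eventually_mul_matPow_mem hnil hφ hI (a x) x] with n hn y
  refine subst_apply_mem hI fun x => ?_
  by_cases hx : a x ∈ I
  · exact mul_mem_of_mem hx _
  · exact hn x hx y

/-- Joint convergence in `(n, x)` makes all terms of the Neumann series one convergent family, so
its sum is again a convergent family and sums may be rearranged. -/
theorem tendsto_subst_matPow (hnil : IsTopLeftTNilpotent H) {φ : X → ConvFam R X}
    (hφ : ∀ x y, φ x y ∈ H) (a : ConvFam R X) :
    Tendsto (fun p : ℕ × X => subst a (matPow φ p.1) p.2) cofinite (𝓝 0) := by
  rw [(IsLinearTopology.hasBasis_open_submodule (R := Rᵐᵒᵖ) (M := R)).tendsto_right_iff]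
  intro I hI
  obtain ⟨N, hN⟩ := eventually_atTop.1 (eventually_subst_matPow_mem hnil hφ hI a)
  have hfin : ∀ n, {x | subst a (matPow φ n) x ∉ I}.Finite := fun n =>
    (subst a (matPow φ n)).2 (hI.mem_nhds I.zero_mem)
  refine Set.Finite.subset ((Set.finite_Iio N).biUnion fun n _ =>
    (hfin n).image fun x => (n, x)) ?_
  rintro ⟨n, x⟩ hnx
  simp only [Set.mem_iUnion]
  exact ⟨n, not_le.1 fun h => hnx (hN n h x), x, hnx, rfl⟩

/-- A square matrix congruent to the identity matrix modulo a topologically left T-nilpotent ideal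
is invertible. -/
theorem subst_bijective (hnil : IsTopLeftTNilpotent H) {g : X → ConvFam R X}
    (hg : ∀ x y, (g x - point x : ConvFam R X) y ∈ H) :
    Function.Bijective fun a : ConvFam R X => subst a g := by
  let φ : X → ConvFam R X := fun x => point x - g x
  have hφ : ∀ x y, φ x y ∈ H := fun x y => by
    have h := H.neg_mem (hg x y)
    rwa [← neg_apply, neg_sub] at h
  have hgφ : ∀ a, subst a g = a - subst a φ := fun a => by
    rw [subst_sub, subst_point, sub_sub_cancel]
  constructor
  -- With `g = 1 - φ`, a kernel element satisfies `a = aφ = aφⁿ` for all `n`, and `aφⁿ` tends to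
  -- zero.
  · refine (injective_iff_map_eq_zero (substₗ g)).2 fun a ha => ?_
    have ha' : a = subst a φ := sub_eq_zero.1 ((hgφ a).symm.trans ha)
    have hpow : ∀ n, subst a (matPow φ n) = a := fun n => by
      induction n with
      | zero => exact subst_point a
      | succ n ih => rw [subst_matPow_succ, ← ha', ih]
    ext y
    have hlim : Tendsto (fun _ : ℕ => a y) atTop (𝓝 0) := by
      rw [(IsLinearTopology.hasBasis_open_submodule (R := Rᵐᵒᵖ) (M := R)).tendsto_right_iff]
      intro I hI
      refine (eventually_subst_matPow_mem hnil hφ hI a).mono fun n hn => ?_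
      rw [← hpow n]
      exact hn y
    exact tendsto_nhds_unique tendsto_const_nhds hlim
  · intro a
    -- The preimage is the Neumann series `b = ∑ aφⁿ`; then `b - bφ` telescopes to `a`.
    let c : ConvFam R (ℕ × X) := ⟨_, tendsto_subst_matPow hnil hφ a⟩
    have hc : ∀ n x, c (n, x) = subst a (matPow φ n) x := fun _ _ => rfl
    let b : ConvFam R X := subst c fun p => point p.2
    have hb : ∀ y, b y = ∑' n, subst a (matPow φ n) y := fun y => by
      rw [subst_apply, (summable_mul c _).tsum_prod]
      refine tsum_congr fun n => ?_
      simp only [hc]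
      exact congr_fun (congr_arg Subtype.val (subst_point (subst a (matPow φ n)))) y
    have hbφ : ∀ y, subst b φ y = ∑' n, subst a (matPow φ (n + 1)) y := fun y => by
      rw [subst_assoc]
      simp only [point_subst]
      rw [subst_apply, (summable_mul c _).tsum_prod]
      refine tsum_congr fun n => ?_
      rw [subst_matPow_succ']
      rfl
    refine ⟨b, ?_⟩
    change subst b g = a
    rw [hgφ]
    ext y
    rw [sub_apply, hb, hbφ]
    have hs : Summable fun n => subst a (matPow φ n) y :=
      summable ((tendsto_subst_matPow hnil hφ a).comp
        (Function.Injective.tendsto_cofinite (f := fun n : ℕ => (n, y))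
          fun m n h => (Prod.ext_iff.1 h).1))
    rw [hs.tsum_eq_zero_add, add_sub_cancel_right]
    exact congr_fun (congr_arg Subtype.val (subst_point a)) y

end Nilpotent

end ConvFam

/-! ### The linear structure of a contramodule -/

namespace Contramodule

open ConvFam

set_option linter.unusedSectionVars false

variable {R : Type u} [Ring R] [UniformSpace R] [IsUniformAddGroup R] [IsTopologicalRing R]
  [IsLinearTopology Rᵐᵒᵖ R] [CompleteSpace R] [T2Space R]

section Structure

variable (A : Contramodule R) {X : Type v} {Y : Type w}

/-- The structure map `R[[A]] → A` of a contramodule. -/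
noncomputable def act (a : ConvFam R A.A) : A.A :=
  (A.a : _ → A.A) a

theorem act_point (m : A.A) : act A (point m) = m :=
  ConcreteCategory.congr_hom A.unit m

theorem act_join (r : ConvFam R (ConvFam R A.A)) :
    act A (join r) = act A (ConvFam.map (act A) r) :=
  ConcreteCategory.congr_hom A.assoc r

/-- The infinite linear combination `∑ a_x f(x)` in a contramodule. -/
noncomputable def ev (a : ConvFam R X) (f : X → A.A) : A.A :=
  act A (ConvFam.map f a)

theorem ev_point (x : X) (f : X → A.A) : ev A (point x) f = f x := by
  rw [ev, map_eq_subst, point_subst, act_point]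

theorem act_eq_ev (a : ConvFam R A.A) : act A a = ev A a fun m => m := by
  rw [ev, map_eq_subst, subst_point]

theorem act_subst (a : ConvFam R X) (g : X → ConvFam R A.A) :
    act A (subst a g) = ev A a fun x => act A (g x) := by
  have h : subst a g = join (ConvFam.map g a) := by
    simp only [join_eq_subst, map_eq_subst, subst_assoc, point_subst]
  rw [h, act_join, ev]
  simp only [map_eq_subst, subst_assoc, point_subst]

theorem ev_subst (a : ConvFam R X) (g : X → ConvFam R Y) (f : Y → A.A) :
    ev A (subst a g) f = ev A a fun x => ev A (g x) f := by
  have h := act_subst A a fun x => subst (g x) fun y => point (f y)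
  simpa only [ev, map_eq_subst, subst_assoc] using h

theorem ev_map (a : ConvFam R X) (g : X → Y) (f : Y → A.A) :
    ev A (ConvFam.map g a) f = ev A a fun x => f (g x) := by
  simp only [map_eq_subst, ev_subst, ev_point]

theorem act_surjective : Function.Surjective (act A) := fun m => ⟨point m, act_point A m⟩

noncomputable instance : Zero A.A := ⟨act A 0⟩
noncomputable instance : Add A.A := ⟨fun m n => act A (point m + point n)⟩
noncomputable instance : Neg A.A := ⟨fun m => act A (-point m)⟩
noncomputable instance : Sub A.A := ⟨fun m n => act A (point m - point n)⟩
noncomputable instance : SMul R A.A := ⟨fun r m => act A (r • point m)⟩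
noncomputable instance : SMul ℕ A.A := ⟨fun r m => act A (r • point m)⟩
noncomputable instance : SMul ℤ A.A := ⟨fun r m => act A (r • point m)⟩

/-- The algebra axiom behind every operation on `A`: inner combinations may be evaluated before the
outer one. Applied to `s = point a + point b` and its analogues, it shows that `act A` preserves the
operations, so the module axioms descend along this surjection. -/
theorem act_map_linear {N : Type*} (a : N → ConvFam R A.A) (s : ConvFam R N) :
    act A (subst s a) = act A (subst s fun i => point (act A (a i))) := by
  rw [act_subst, act_subst]
  simp only [act_point]

theorem act_add (a b : ConvFam R A.A) : act A (a + b) = act A a + act A b := by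
  have h := act_map_linear A (fun i => i) (point a + point b)
  simp only [add_subst, point_subst] at h
  exact h

theorem act_neg (a : ConvFam R A.A) : act A (-a) = -act A a := by
  have h := act_map_linear A (fun i => i) (-point a)
  have hn : ∀ g : ConvFam R A.A → ConvFam R A.A, subst (-point a) g = -subst (point a) g :=
    fun g => map_neg (substₗ g) _
  simp only [hn, point_subst] at h
  exact h

theorem act_sub (a b : ConvFam R A.A) : act A (a - b) = act A a - act A b := by
  have h := act_map_linear A (fun i => i) (point a - point b)
  simp only [sub_subst, point_subst] at h
  exact h

theorem act_smul (r : R) (a : ConvFam R A.A) : act A (r • a) = r • act A a := by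
  have h := act_map_linear A (fun i => i) (r • point a)
  simp only [smul_subst, point_subst] at h
  exact h

theorem act_nsmul (r : ℕ) (a : ConvFam R A.A) : act A (r • a) = r • act A a := by
  have h := act_map_linear A (fun i => i) (r • point a)
  have hn : ∀ g : ConvFam R A.A → ConvFam R A.A, subst (r • point a) g = r • subst (point a) g :=
    fun g => map_nsmul (substₗ g) _ _
  simp only [hn, point_subst] at h
  exact h

theorem act_zsmul (r : ℤ) (a : ConvFam R A.A) : act A (r • a) = r • act A a := by
  have h := act_map_linear A (fun i => i) (r • point a)
  have hn : ∀ g : ConvFam R A.A → ConvFam R A.A, subst (r • point a) g = r • subst (point a) g :=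
    fun g => map_zsmul (substₗ g) _ _
  simp only [hn, point_subst] at h
  exact h

noncomputable instance : AddCommGroup A.A :=
  (act_surjective A).addCommGroup (act A) rfl (act_add A) (act_neg A) (act_sub A)
    (fun a r => act_nsmul A r a) (fun a r => act_zsmul A r a)

/-- The structure map as an additive map. -/
noncomputable def actHom : ConvFam R A.A →+ A.A where
  toFun := act A
  map_zero' := rfl
  map_add' := act_add A

noncomputable instance : Module R A.A :=
  (act_surjective A).module R (actHom A) (act_smul A)

theorem ev_add (a b : ConvFam R X) (f : X → A.A) : ev A (a + b) f = ev A a f + ev A b f := by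
  simp only [ev, map_eq_subst, add_subst, act_add]

theorem ev_smul (r : R) (a : ConvFam R X) (f : X → A.A) : ev A (r • a) f = r • ev A a f := by
  simp only [ev, map_eq_subst, smul_subst, act_smul]

/-- Infinite linear combinations of a fixed family of elements, as a linear map. -/
noncomputable def evₗ (f : X → A.A) : ConvFam R X →ₗ[R] A.A where
  toFun a := ev A a f
  map_add' a b := ev_add A a b f
  map_smul' r a := ev_smul A r a f

theorem ev_sub (a b : ConvFam R X) (f : X → A.A) : ev A (a - b) f = ev A a f - ev A b f :=
  map_sub (evₗ A f) a b

theorem ev_add_right (a : ConvFam R X) (f g : X → A.A) :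
    ev A a (fun x => f x + g x) = ev A a f + ev A a g := by
  have h := ev_subst A a (fun x => point (f x) + point (g x)) fun m => m
  rw [subst_add, ev_add, ev_subst, ev_subst] at h
  simpa only [ev_add, ev_point] using h.symm

theorem ev_zero_right (a : ConvFam R X) : ev A a (fun _ => 0) = 0 := by
  have h := ev_add_right A a (fun _ => 0) fun _ => 0
  simpa using h

theorem ev_sub_right (a : ConvFam R X) (f g : X → A.A) :
    ev A a (fun x => f x - g x) = ev A a f - ev A a g := by
  rw [eq_sub_iff_add_eq, ← ev_add_right]
  simp

end Structure

/-! ### Homomorphisms -/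

section Hom

variable {A B : Contramodule R} {X : Type v}

theorem hom_act (f : A ⟶ B) (a : ConvFam R A.A) :
    f.f (act A a) = act B (ConvFam.map f.f a) :=
  (ConcreteCategory.congr_hom f.h a).symm

theorem hom_ev (f : A ⟶ B) (a : ConvFam R X) (g : X → A.A) :
    f.f (ev A a g) = ev B a fun x => f.f (g x) := by
  rw [ev, hom_act, act_eq_ev, ev_map, ev_map]

theorem hom_sub (f : A ⟶ B) (m n : A.A) : f.f (m - n) = f.f m - f.f n := by
  change f.f (act A (point m - point n)) = act B (point (f.f m) - point (f.f n))
  rw [hom_act, map_eq_subst, sub_subst, point_subst, point_subst]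

/-- A map which preserves infinite linear combinations is a homomorphism of contramodules. -/
noncomputable def homMk (f : A.A → B.A)
    (h : ∀ a : ConvFam R A.A, f (act A a) = ev B a f) : A ⟶ B where
  f := TypeCat.ofHom f
  h := by
    ext a : 3
    exact (h a).symm

theorem homMk_apply (f : A.A → B.A) (h : ∀ a : ConvFam R A.A, f (act A a) = ev B a f) (m : A.A) :
    (homMk f h).f m = f m := rfl

theorem comp_apply {C : Contramodule R} (f : A ⟶ B) (g : B ⟶ C) (m : A.A) :
    (f ≫ g).f m = g.f (f.f m) := rfl

theorem hom_ext {f g : A ⟶ B} (h : ∀ m, f.f m = g.f m) : f = g := by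
  apply Monad.Algebra.Hom.ext
  ext m
  exact h m

theorem epi_of_surjective (f : A ⟶ B) (hf : Function.Surjective f.f) : Epi f where
  left_cancellation g h hgh := hom_ext fun m => by
    obtain ⟨n, rfl⟩ := hf m
    rw [← comp_apply, hgh, comp_apply]

theorem isIso_of_bijective (f : A ⟶ B) (hf : Function.Bijective f.f) : IsIso f := by
  have : IsIso f.f := (isIso_iff_bijective f.f).2 hf
  exact Monad.algebra_iso_of_iso _ f

end Hom

/-! ### Quotients -/

section Quotient

variable {A : Contramodule R} {X : Type v}

/-- A submodule is a subcontramodule if it is closed under infinite linear combinations. -/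
def IsSubcontramodule (N : Submodule R A.A) : Prop :=
  ∀ (a : ConvFam R A.A) (f : A.A → A.A), (∀ m, f m ∈ N) → ev A a f ∈ N

theorem IsSubcontramodule.ev_mem {N : Submodule R A.A} (hN : IsSubcontramodule N)
    (a : ConvFam R X) {f : X → A.A} (hf : ∀ x, f x ∈ N) : ev A a f ∈ N := by
  classical
  -- The definition tests only combinations indexed by `A` itself, with all values in `N`. Hence `a`
  -- is pushed forward along `f`, and values outside `N`, which do not occur, are replaced by `0`.
  have h := hN (ConvFam.map f a) (fun m => if m ∈ N then m else 0) fun m => by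
    split_ifs with hm
    · exact hm
    · exact N.zero_mem
  rw [ev_map] at h
  simpa only [hf, if_true] using h

/-- Independence of representatives, which makes the action through `Quotient.out` satisfy the
algebra axioms. -/
theorem IsSubcontramodule.mkQ_ev_congr {N : Submodule R A.A} (hN : IsSubcontramodule N)
    (a : ConvFam R X) {f g : X → A.A} (h : ∀ x, N.mkQ (f x) = N.mkQ (g x)) :
    N.mkQ (ev A a f) = N.mkQ (ev A a g) := by
  rw [Submodule.mkQ_apply, Submodule.mkQ_apply, Submodule.Quotient.eq, ← ev_sub_right]
  exact hN.ev_mem a fun x => (Submodule.Quotient.eq N).1 (h x)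

/-- The quotient of a contramodule by a subcontramodule. -/
noncomputable def quotient {N : Submodule R A.A} (hN : IsSubcontramodule N) : Contramodule R where
  A := A.A ⧸ N
  a := TypeCat.ofHom fun a : ConvFam R (A.A ⧸ N) => N.mkQ (ev A a Quotient.out)
  unit := by
    ext q
    change N.mkQ (ev A (point q) Quotient.out) = q
    rw [ev_point]
    exact Quotient.out_eq q
  assoc := by
    ext r
    have key (r : ConvFam R (ConvFam R (A.A ⧸ N))) : N.mkQ (ev A (join r) Quotient.out) =
        N.mkQ (ev A (ConvFam.map (fun a => N.mkQ (ev A a Quotient.out)) r) Quotient.out) := by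
      rw [join_eq_subst, ev_subst, ev_map]
      exact hN.mkQ_ev_congr r fun x => (Quotient.out_eq (N.mkQ _)).symm
    exact key r

/-- The projection onto the quotient by a subcontramodule. -/
noncomputable def quotientMk {N : Submodule R A.A} (hN : IsSubcontramodule N) :
    A ⟶ quotient hN :=
  homMk (B := quotient hN) (fun m => N.mkQ m) fun a => by
    change _ = N.mkQ (ev A (ConvFam.map _ a) Quotient.out)
    rw [ev_map, act_eq_ev]
    exact hN.mkQ_ev_congr a fun x => (Quotient.out_eq (N.mkQ x)).symm

theorem quotientMk_surjective {N : Submodule R A.A} (hN : IsSubcontramodule N) :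
    Function.Surjective (quotientMk hN).f :=
  N.mkQ_surjective

theorem quotientMk_eq_iff {N : Submodule R A.A} (hN : IsSubcontramodule N) {m n : A.A} :
    (quotientMk hN).f m = (quotientMk hN).f n ↔ m - n ∈ N :=
  Submodule.Quotient.eq N

/-- The image is a subcontramodule. The projection onto its quotient and the zero map agree after
`f`, hence coincide, so the quotient vanishes. -/
theorem surjective_of_epi {A B : Contramodule R} (f : A ⟶ B) [Epi f] :
    Function.Surjective f.f := by
  let N : Submodule R B.A :=
    { carrier := Set.range f.f
      add_mem' := by
        rintro _ _ ⟨m, rfl⟩ ⟨n, rfl⟩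
        refine ⟨act A (point m + point n), ?_⟩
        rw [hom_act, map_eq_subst, add_subst, point_subst, point_subst, act_add, act_point,
          act_point]
      zero_mem' := by
        refine ⟨act A 0, ?_⟩
        rw [act_eq_ev, hom_ev]
        exact map_zero (evₗ B _)
      smul_mem' := by
        rintro r _ ⟨m, rfl⟩
        refine ⟨act A (r • point m), ?_⟩
        rw [hom_act, map_eq_subst, smul_subst, point_subst, act_smul, act_point] }
  have hN : IsSubcontramodule N := fun a g hg => by
    choose s hs using hg
    refine ⟨ev A a s, ?_⟩
    rw [hom_ev]
    simp only [hs]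
  let z : B ⟶ quotient hN := homMk (fun _ => 0) fun a => (ev_zero_right _ a).symm
  have hz : f ≫ quotientMk hN = f ≫ z := hom_ext fun m => by
    rw [comp_apply, comp_apply]
    have h0 : (quotientMk hN).f 0 = 0 := by
      rw [← sub_self (0 : B.A), hom_sub, sub_self]
    rw [homMk_apply, ← h0, quotientMk_eq_iff, sub_zero]
    exact ⟨m, rfl⟩
  intro m
  have hm : (quotientMk hN).f m = (quotientMk hN).f 0 := by
    rw [(cancel_epi f).1 hz]
    rfl
  rw [quotientMk_eq_iff, sub_zero] at hm
  exact hm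

end Quotient

/-! ### Reduction modulo an ideal -/

section Reduction

variable {H : Ideal R} {A : Contramodule R} {X : Type v} {Y : Type w}

theorem _root_.ConvFam.subst_mem_of_left [H.IsTwoSided] (hH : IsClosed (H : Set R))
    {a : ConvFam R X} (ha : ∀ x, a x ∈ H) (g : X → ConvFam R Y) (y : Y) : subst a g y ∈ H :=
  tsum_mem (s := H) hH fun x => H.mul_mem_right _ (ha x)

theorem _root_.ConvFam.subst_mem_of_right (hH : IsClosed (H : Set R)) (a : ConvFam R X)
    {g : X → ConvFam R Y} (hg : ∀ x y, g x y ∈ H) (y : Y) : subst a g y ∈ H :=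
  tsum_mem (s := H) hH fun x => H.mul_mem_left _ (hg x y)

variable (A) in
/-- The submodule `H ⋌ A` of all infinite linear combinations with coefficients in `H`. -/
noncomputable def idealSpan (H : Ideal R) [H.IsTwoSided] : Submodule R A.A where
  carrier := {m | ∃ h : ConvFam R A.A, (∀ x, h x ∈ H) ∧ act A h = m}
  add_mem' := by
    rintro _ _ ⟨h, hh, rfl⟩ ⟨k, hk, rfl⟩
    exact ⟨h + k, fun x => H.add_mem (hh x) (hk x), act_add A h k⟩
  zero_mem' := ⟨0, fun _ => H.zero_mem, rfl⟩
  smul_mem' := by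
    rintro r _ ⟨h, hh, rfl⟩
    exact ⟨r • h, fun x => H.mul_mem_left r (hh x), act_smul A r h⟩

theorem isSubcontramodule_idealSpan [H.IsTwoSided] (hH : IsClosed (H : Set R)) :
    IsSubcontramodule (idealSpan A H) := fun a f hf => by
  choose h hh hf using hf
  refine ⟨subst a h, ConvFam.subst_mem_of_right hH a hh, ?_⟩
  rw [act_subst]
  simp only [hf]

theorem ev_mem_idealSpan [H.IsTwoSided] (hH : IsClosed (H : Set R)) {h : ConvFam R X}
    (hh : ∀ x, h x ∈ H) (f : X → A.A) : ev A h f ∈ idealSpan A H :=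
  ⟨ConvFam.map f h, fun y => by
    rw [map_eq_subst]
    exact ConvFam.subst_mem_of_left hH hh _ y, rfl⟩

/-- The reduction `A / (H ⋌ A)` of a contramodule. -/
noncomputable abbrev reduction [H.IsTwoSided] (hH : IsClosed (H : Set R)) (A : Contramodule R) :
    Contramodule R :=
  quotient (isSubcontramodule_idealSpan (A := A) hH)

/-- After lifting the values of `f` to `A`, the combination is the image of an element of `idealSpan
A H`. -/
theorem ev_reduction_eq_zero [H.IsTwoSided] (hH : IsClosed (H : Set R)) {h : ConvFam R X}
    (hh : ∀ x, h x ∈ H) (f : X → (reduction hH A).A) : ev (reduction hH A) h f = 0 := by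
  choose g hg using fun x => quotientMk_surjective (isSubcontramodule_idealSpan (A := A) hH) (f x)
  obtain rfl : (fun x => (quotientMk (isSubcontramodule_idealSpan (A := A) hH)).f (g x)) = f :=
    funext hg
  rw [← hom_ev, ← sub_self ((quotientMk (isSubcontramodule_idealSpan (A := A) hH)).f 0), ← hom_sub,
    quotientMk_eq_iff, sub_self, sub_zero]
  exact ev_mem_idealSpan hH hh g

end Reduction

end Contramodule

/-! ### Projective contramodules cut out by diagonal idempotents -/

namespace Contramodule

open ConvFam

set_option linter.unusedSectionVars false

variable {R : Type u} [Ring R] [UniformSpace R] [IsUniformAddGroup R] [IsTopologicalRing R]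
  [IsLinearTopology Rᵐᵒᵖ R] [CompleteSpace R] [T2Space R]

/-- The diagonal matrix with the given entries. -/
noncomputable def diagonal {X : Type v} (e : X → R) (x : X) : ConvFam R X :=
  e x • point x

theorem ev_subst_diagonal (A : Contramodule R) {X : Type v} (e : X → R) (a : ConvFam R X)
    (f : X → A.A) : ev A (subst a (diagonal e)) f = ev A a fun x => e x • f x := by
  rw [ev_subst]
  simp only [diagonal, ev_smul, ev_point]

theorem subst_diagonal_apply {X : Type v} (e : X → R) (a : ConvFam R X) (x : X) :
    subst a (diagonal e) x = a x * e x :=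
  subst_smul_point a e x

variable {X : Type u}

/-- The convergent families `a` with `a x ∈ R e_x`. -/
abbrev IdemFamily (e : X → R) : Type u :=
  {a : ConvFam R X // ∀ x, a x * e x = a x}

/-- The contramodule of convergent families `a` with `a x ∈ R e_x`, the coproduct of the projective
contramodules `R e_x`. -/
noncomputable def coprodIdem (e : X → R) : Contramodule R where
  A := IdemFamily e
  a := TypeCat.ofHom fun r : ConvFam R (IdemFamily e) =>
    (⟨subst r Subtype.val, fun x => by
      rw [subst_apply, ← (summable_mul r _).tsum_mul_right]
      exact tsum_congr fun a => by rw [mul_assoc, a.2 x]⟩ : IdemFamily e)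
  unit := by
    ext a : 3
    have key (a : IdemFamily e) : subst (point a) Subtype.val = a.1 := point_subst a _
    exact Subtype.ext (key a)
  assoc := by
    ext r : 3
    apply Subtype.ext
    have key (r : ConvFam R (ConvFam R (IdemFamily e)))
        (h : ConvFam R (IdemFamily e) →
          IdemFamily e) (hh : ∀ s, (h s).1 = subst s Subtype.val) :
        subst (join r) Subtype.val = subst (ConvFam.map h r) Subtype.val := by
      rw [join_eq_subst, map_eq_subst, subst_assoc, subst_assoc]
      simp only [point_subst, hh]
    exact key r _ fun _ => rfl

/-- The underlying family of an element of `coprodIdem e`. -/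
def family {e : X → R} (p : (coprodIdem e).A) : ConvFam R X :=
  Subtype.val (p := fun a : ConvFam R X => ∀ x, a x * e x = a x) p

theorem family_mul {e : X → R} (p : (coprodIdem e).A) (x : X) : family p x * e x = family p x :=
  Subtype.prop (p := fun a : ConvFam R X => ∀ x, a x * e x = a x) p x

theorem family_injective {e : X → R} : Function.Injective (family (e := e)) :=
  Subtype.val_injective

theorem family_act {e : X → R} (r : ConvFam R (coprodIdem e).A) :
    family (act (coprodIdem e) r) = subst r family := rfl

theorem family_ev {e : X → R} {Y : Type v} (a : ConvFam R Y) (f : Y → (coprodIdem e).A) :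
    family (ev (coprodIdem e) a f) = subst a fun y => family (f y) := by
  rw [ev, family_act, map_eq_subst, subst_assoc]
  simp only [point_subst]

theorem family_sub {e : X → R} (p q : (coprodIdem e).A) : family (p - q) = family p - family q := by
  change family (act _ (point p - point q)) = _
  rw [family_act, sub_subst, point_subst, point_subst]

variable {e : X → R}

theorem subst_diagonal_family (p : (coprodIdem e).A) : subst (family p) (diagonal e) = family p := by
  ext x
  rw [subst_diagonal_apply, family_mul]

/-- The projection of the free contramodule onto `coprodIdem e`. -/
noncomputable def proj (he : ∀ x, IsIdempotentElem (e x)) (a : ConvFam R X) : (coprodIdem e).A :=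
  (⟨subst a (diagonal e), fun x => by
    rw [subst_diagonal_apply, mul_assoc, (he x).eq]⟩ : IdemFamily e)

theorem family_proj (he : ∀ x, IsIdempotentElem (e x)) (a : ConvFam R X) :
    family (proj he a) = subst a (diagonal e) := rfl

theorem proj_family (he : ∀ x, IsIdempotentElem (e x)) (p : (coprodIdem e).A) :
    proj he (family p) = p :=
  family_injective (subst_diagonal_family p)

theorem proj_eq_ev (he : ∀ x, IsIdempotentElem (e x)) (a : ConvFam R X) :
    proj he a = ev (coprodIdem e) a fun x => proj he (point x) := by
  apply family_injective
  rw [family_ev]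
  simp only [family_proj, point_subst]

/-- The homomorphism from `coprodIdem e` with prescribed values on the generators. -/
noncomputable def coprodDesc (A : Contramodule R) (y : X → A.A) : coprodIdem e ⟶ A :=
  homMk (fun p => ev A (family p) y) fun r => by
    rw [family_act, ev_subst]

theorem coprodDesc_apply (A : Contramodule R) (y : X → A.A) (p : (coprodIdem e).A) :
    (coprodDesc A y).f p = ev A (family p) y := rfl

theorem hom_apply_eq_ev (he : ∀ x, IsIdempotentElem (e x)) {A : Contramodule R}
    (f : coprodIdem e ⟶ A) (a : ConvFam R X) :
    f.f (proj he a) = ev A a fun x => f.f (proj he (point x)) := by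
  rw [proj_eq_ev, hom_ev]

/-- It suffices to lift the images of the generators. The lifts `y x` need not be fixed by `e x`,
since the coefficients of an element already absorb `e x` on the right. -/
theorem projective_coprodIdem (he : ∀ x, IsIdempotentElem (e x)) : Projective (coprodIdem e) where
  factors {E B} f g _ := by
    choose y hy using fun x => surjective_of_epi g (f.f (proj he (point x)))
    refine ⟨coprodDesc E y, hom_ext fun p => ?_⟩
    rw [comp_apply, coprodDesc_apply, hom_ev]
    simp only [hy]
    rw [← hom_apply_eq_ev, proj_family]

/-! ### Projective covers from bases of the reduction -/

variable {H : Ideal R}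

/-- An endomorphism of `coprodIdem e` which is the identity modulo a topologically left T-nilpotent
ideal is bijective. -/
theorem bijective_of_sub_mem (hnil : IsTopLeftTNilpotent H) (he : ∀ x, IsIdempotentElem (e x))
    (f : coprodIdem e ⟶ coprodIdem e)
    (hf : ∀ p x, family (f.f p - p) x ∈ H) : Function.Bijective f.f := by
  -- `R[[X]]` is the sum of `coprodIdem e` and the families with `a x * e x = 0`. The matrix `g`
  -- extends `f` by the identity on the second summand, so it is the identity modulo `H`.
  let g : X → ConvFam R X := fun x =>
    family (f.f (proj he (point x))) + (point x - diagonal e x)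
  have hg : ∀ x y, (g x - point x : ConvFam R X) y ∈ H := fun x y => by
    have h := hf (proj he (point x)) y
    rw [family_sub, family_proj, point_subst] at h
    rwa [show g x - point x = family (f.f (proj he (point x))) - diagonal e x by
      simp only [g]; abel]
  have hsub : ∀ a, subst a g = family (f.f (proj he a)) + (a - subst a (diagonal e)) := fun a => by
    rw [subst_add, subst_sub, subst_point, hom_apply_eq_ev, family_ev]
  obtain ⟨hinj, hsurj⟩ := subst_bijective hnil hg
  constructor
  · intro p q hpq
    apply family_injective
    apply hinj
    simp only [hsub, subst_diagonal_family, proj_family, hpq, sub_self]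
  · intro p
    obtain ⟨a, ha⟩ := hsurj (family p)
    refine ⟨proj he a, family_injective ?_⟩
    have hd : subst (subst a (diagonal e)) (diagonal e) = subst a (diagonal e) :=
      subst_diagonal_family (proj he a)
    have ha' : subst (subst a g) (diagonal e) = family p := by
      rw [show subst a g = family p from ha, subst_diagonal_family]
    rwa [hsub, add_subst, sub_subst, subst_diagonal_family, hd, sub_self, add_zero] at ha'

/-- Nakayama's lemma: a homomorphism which is surjective modulo a topologically left T-nilpotent
ideal is surjective. -/
theorem surjective_of_surjective_mod [H.IsTwoSided] (hnil : IsTopLeftTNilpotent H)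
    {A C : Contramodule R} (f : A ⟶ C)
    (hf : ∀ c, ∃ a, c - f.f a ∈ idealSpan C H) : Function.Surjective f.f := by
  -- Each `c` equals `f (s c)` plus the value of `h c`, a combination with coefficients in `H`. The
  -- matrix `1 - h`, indexed by `C` itself, is invertible; writing `point c = b(1 - h)` and
  -- evaluating gives `c = ∑ b_x f(s x)`.
  choose s h hh hs using hf
  have hg : ∀ x y, (point x - h x - point x : ConvFam R C.A) y ∈ H := fun x y => by
    rw [show point x - h x - point x = -h x by abel]
    exact H.neg_mem (hh x y)
  intro c
  obtain ⟨b, hb⟩ := (subst_bijective hnil hg).2 (point c)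
  refine ⟨ev A b s, ?_⟩
  rw [hom_ev, ← act_point C c, ← hb, act_subst]
  congr 1
  funext x
  rw [act_sub, act_point, hs, sub_sub_cancel]

/-- The spanning hypothesis makes the lifted map surjective modulo `H`, so Nakayama applies.
Independence shows that an endomorphism compatible with `p` is the identity modulo `H`. -/
theorem exists_isProjectiveCover_of_basis [H.IsTwoSided] (hH : IsClosed (H : Set R))
    (hnil : IsTopLeftTNilpotent H) (C : Contramodule R) (he : ∀ x, IsIdempotentElem (e x))
    (d : X → (reduction hH C).A) (hd : ∀ x, e x • d x = d x)
    (hspan : ∀ m, ∃ a : ConvFam R X, ev (reduction hH C) a d = m)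
    (hindep : ∀ a : ConvFam R X, (∀ x, a x * e x = a x) → ev (reduction hH C) a d = 0 →
      ∀ x, a x ∈ H) :
    ∃ (P : Contramodule R) (p : P ⟶ C), IsProjectiveCover p := by
  let hN := isSubcontramodule_idealSpan (A := C) hH
  choose c hc using fun x => quotientMk_surjective hN (d x)
  let p : coprodIdem e ⟶ C := coprodDesc C c
  have hp : ∀ q, (quotientMk hN).f (p.f q) = ev (reduction hH C) (family q) d := fun q => by
    rw [coprodDesc_apply, hom_ev]
    simp only [hc]
  refine ⟨coprodIdem e, p, epi_of_surjective p ?_, projective_coprodIdem he, fun f hf => ?_⟩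
  · refine surjective_of_surjective_mod hnil p fun m => ?_
    obtain ⟨a, ha⟩ := hspan ((quotientMk hN).f m)
    refine ⟨proj he a, (quotientMk_eq_iff hN).1 ?_⟩
    rw [hp, family_proj, ev_subst_diagonal, ← ha]
    simp only [hd]
  · refine isIso_of_bijective f (bijective_of_sub_mem hnil he f fun q => ?_)
    refine hindep _ (family_mul _) ?_
    rw [← hp, hom_sub, ← comp_apply, hf, sub_self, ← sub_self ((quotientMk hN).f 0), ← hom_sub,
      sub_self]

end Contramodule

/-! ### Lifting idempotents -/

section Idempotents

open Polynomial in
-- The iteration `q ↦ 3q² - 2q³` squares the error `q² - q` up to a factor. The weaker exponent `n +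
-- 1` is all that convergence needs.
theorem exists_polynomial_seq : ∃ p : ℕ → ℤ[X], p 0 = X ∧ (∀ n, p n ^ 2 - p n ∣ p (n + 1) - p n) ∧
    ∀ n, (X ^ 2 - X) ^ (n + 1) ∣ p n ^ 2 - p n := by
  let p : ℕ → ℤ[X] := fun n => Nat.rec X (fun _ q => 3 * q ^ 2 - 2 * q ^ 3) n
  have hp : ∀ n, p (n + 1) = 3 * p n ^ 2 - 2 * p n ^ 3 := fun _ => rfl
  refine ⟨p, rfl, fun n => ⟨1 - 2 * p n, ?_⟩, fun n => ?_⟩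
  · rw [hp]
    ring
  · induction n with
    | zero =>
      rw [zero_add, pow_one]
      exact dvd_refl _
    | succ n ih =>
      have h : p (n + 1) ^ 2 - p (n + 1) =
          (p n ^ 2 - p n) * (p n ^ 2 - p n) * (4 * (p n ^ 2 - p n) - 3) := by
        rw [hp]
        ring
      rw [h]
      refine Dvd.dvd.mul_right (dvd_trans ?_ (mul_dvd_mul ih ih)) _
      rw [← pow_add]
      exact pow_dvd_pow _ (by omega)

variable {R : Type u} [Ring R] [UniformSpace R] [IsUniformAddGroup R] [IsTopologicalRing R]
  [IsLinearTopology Rᵐᵒᵖ R] [CompleteSpace R] [T2Space R] {H : Ideal R} [H.IsTwoSided]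

open Polynomial in
/-- Idempotents lift modulo a closed topologically left T-nilpotent two-sided ideal. -/
theorem exists_isIdempotentElem_sub_mem (hH : IsClosed (H : Set R)) (hnil : IsTopLeftTNilpotent H)
    {a : R} (ha : a * a - a ∈ H) : ∃ e, IsIdempotentElem e ∧ e - a ∈ H := by
  obtain ⟨p, hp0, hpd, hpX⟩ := exists_polynomial_seq
  choose q hq using fun n => (hpX n).trans (hpd n)
  choose q' hq' using hpX
  let b : ℕ → R := fun n => aeval a (p n)
  have hXa : aeval a (X ^ 2 - X : ℤ[X]) = a * a - a := by
    simp [pow_two]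
  have hpow : Tendsto (fun n : ℕ => (a * a - a) ^ (n + 1)) atTop (𝓝 0) := by
    simpa using hnil (fun _ => a * a - a) fun _ => ha
  have hb : ∀ n, b (n + 1) - b n = (a * a - a) ^ (n + 1) * aeval a (q n) := fun n => by
    rw [← hXa, ← map_pow, ← map_mul, ← hq, map_sub]
  have hb' : ∀ n, b n ^ 2 - b n = (a * a - a) ^ (n + 1) * aeval a (q' n) := fun n => by
    rw [← hXa, ← map_pow (aeval a) (X ^ 2 - X), ← map_mul, ← hq', map_sub, map_pow]
  -- Powers of `a * a - a` tend to zero, and right multiplication by arbitrary elements preserves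
  -- this. Thus the increments are summable and `b` converges.
  have hsum : Summable fun n => b (n + 1) - b n := by
    refine ConvFam.summable ?_
    rw [Nat.cofinite_eq_atTop]
    simp only [hb]
    exact IsLinearTopology.tendsto_mul_zero_of_left _ _ hpow
  have hb0 : b 0 = a := by
    simp [b, hp0]
  let s : R := ∑' n, (b (n + 1) - b n)
  have hlim : Tendsto b atTop (𝓝 (a + s)) := by
    have h := hsum.hasSum.tendsto_sum_nat
    simp only [Finset.sum_range_sub, hb0] at h
    simpa using h.const_add a
  refine ⟨a + s, ?_, ?_⟩
  · have h1 : Tendsto (fun n => b n ^ 2 - b n) atTop (𝓝 ((a + s) ^ 2 - (a + s))) :=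
      (hlim.pow 2).sub hlim
    have h2 : Tendsto (fun n => b n ^ 2 - b n) atTop (𝓝 0) := by
      simp only [hb']
      exact IsLinearTopology.tendsto_mul_zero_of_left _ _ hpow
    have h3 := sub_eq_zero.1 (tendsto_nhds_unique h1 h2)
    rwa [pow_two] at h3
  · rw [add_sub_cancel_left]
    refine tsum_mem (s := H) hH fun n => ?_
    rw [hb]
    exact H.mul_mem_right _ (H.pow_mem_of_mem ha _ n.succ_pos)

end Idempotents

/-! ### Reductions which are products of semisimple rings -/

section Product

open ConvFam Contramodule

set_option linter.unusedSectionVars false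

variable {R : Type u} [Ring R] [UniformSpace R] [IsUniformAddGroup R] [IsTopologicalRing R]
  [IsLinearTopology Rᵐᵒᵖ R] [CompleteSpace R] [T2Space R]

/-- The homomorphisms `φ γ : R → S γ` identify `R / H` with the topological product of the discrete
rings `S γ`, and convergent families in the product lift to convergent families in `R`. -/
structure IsProductReduction (H : Ideal R) {Γ : Type v} {S : Γ → Type w} [∀ γ, Ring (S γ)]
    (φ : ∀ γ, R →+* S γ) : Prop where
  isOpen_ker : ∀ γ, IsOpen (RingHom.ker (φ γ) : Set R)
  mem_iff : ∀ r, r ∈ H ↔ ∀ γ, φ γ r = 0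
  lift : ∀ (X : Type u) (s : X → ∀ γ, S γ), (∀ γ, {x | s x γ ≠ 0}.Finite) →
    ∃ a : ConvFam R X, ∀ x γ, φ γ (a x) = s x γ

/-- A contramodule is annihilated by `H` if all infinite linear combinations with coefficients in
`H` vanish. -/
def Contramodule.IsAnnihilated (H : Ideal R) (D : Contramodule R) : Prop :=
  ∀ h : ConvFam R D.A, (∀ x, h x ∈ H) → act D h = 0

namespace IsProductReduction

variable {H : Ideal R} [H.IsTwoSided] {Γ : Type u} {S : Γ → Type w} [∀ γ, Ring (S γ)]
  {φ : ∀ γ, R →+* S γ} {X : Type v} {D : Contramodule R}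

theorem isClosed (hφ : IsProductReduction H φ) : IsClosed (H : Set R) := by
  have h : (H : Set R) = ⋂ γ, (RingHom.ker (φ γ) : Set R) := by
    ext r
    simp [hφ.mem_iff]
  rw [h]
  exact isClosed_iInter fun γ =>
    AddSubgroup.isClosed_of_isOpen (RingHom.ker (φ γ)).toAddSubgroup (hφ.isOpen_ker γ)

theorem ev_eq_zero (hφ : IsProductReduction H φ) (hD : D.IsAnnihilated H) {h : ConvFam R X}
    (hh : ∀ x, h x ∈ H) (f : X → D.A) : ev D h f = 0 :=
  hD _ fun y => by
    rw [map_eq_subst]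
    exact ConvFam.subst_mem_of_left hφ.isClosed hh _ y

theorem ev_congr (hφ : IsProductReduction H φ) (hD : D.IsAnnihilated H) {a b : ConvFam R X}
    (hab : ∀ x γ, φ γ (a x) = φ γ (b x)) (f : X → D.A) : ev D a f = ev D b f := by
  rw [← sub_eq_zero, ← ev_sub]
  refine hφ.ev_eq_zero hD (fun x => (hφ.mem_iff _).2 fun γ => ?_) f
  rw [ConvFam.sub_apply, map_sub, hab, sub_self]

theorem smul_congr (hφ : IsProductReduction H φ) (hD : D.IsAnnihilated H) {r s : R}
    (hrs : ∀ γ, φ γ r = φ γ s) (d : D.A) : r • d = s • d := by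
  have h (t : R) : t • d = ev D (t • point ()) fun _ => d := by
    rw [ev_smul, ev_point]
  rw [h, h]
  refine hφ.ev_congr hD (fun x γ => ?_) _
  simp only [ConvFam.smul_apply, map_mul, hrs]

theorem exists_apply_eq (hφ : IsProductReduction H φ) (s : ∀ γ, S γ) : ∃ r, ∀ γ, φ γ r = s γ := by
  obtain ⟨a, ha⟩ := hφ.lift PUnit (fun _ => s) fun _ => Set.toFinite _
  exact ⟨a PUnit.unit, ha _⟩

theorem surjective (hφ : IsProductReduction H φ) (γ : Γ) : Function.Surjective (φ γ) := by
  classical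
  intro s
  obtain ⟨r, hr⟩ := hφ.exists_apply_eq (Pi.single γ s)
  exact ⟨r, by rw [hr, Pi.single_eq_same]⟩

theorem finite_support (hφ : IsProductReduction H φ) (a : ConvFam R X) (γ : Γ) :
    {x | φ γ (a x) ≠ 0}.Finite :=
  a.2 ((hφ.isOpen_ker γ).mem_nhds (map_zero (φ γ)))

open Classical in
/-- A convergent family lifting the central idempotents of the factors. -/
theorem exists_unit (hφ : IsProductReduction H φ) :
    ∃ u : ConvFam R Γ, ∀ γ γ', φ γ' (u γ) = if γ' = γ then 1 else 0 :=
  hφ.lift Γ (fun γ γ' => if γ' = γ then 1 else 0) fun γ' =>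
    (Set.finite_singleton γ').subset fun γ h => by
      by_contra hne
      exact h (if_neg fun h' => hne h'.symm)

theorem apply_tsum (hφ : IsProductReduction H φ) (a : ConvFam R X) (x₀ : X) (γ : Γ)
    (h : ∀ x, x ≠ x₀ → φ γ (a x) = 0) : φ γ (∑' x, a x) = φ γ (a x₀) := by
  classical
  have hb : ∑' x, a x = a x₀ + ∑' x, ite (x = x₀) 0 (a x) := (summable a.2).tsum_eq_add_tsum_ite x₀
  have hc : ∑' x, ite (x = x₀) 0 (a x) ∈ RingHom.ker (φ γ) := by
    refine tsum_mem (s := RingHom.ker (φ γ)) (AddSubgroup.isClosed_of_isOpen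
      (RingHom.ker (φ γ)).toAddSubgroup (hφ.isOpen_ker γ)) fun x => ?_
    split_ifs with hx
    · exact zero_mem _
    · exact h x hx
  rw [hb, map_add, RingHom.mem_ker.1 hc, add_zero]

/-! ### Components cut out by the lifted central idempotents -/

section Unit

variable {u : ConvFam R Γ} [DecidableEq Γ]

/-- Modulo `H` each `u γ` is idempotent and `∑ u γ = 1`, so the combination becomes `(∑ u γ) • d =
d`. -/
theorem ev_unit_smul (hφ : IsProductReduction H φ) (hD : D.IsAnnihilated H)
    (hu : ∀ γ γ', φ γ' (u γ) = if γ' = γ then 1 else 0) (d : D.A) :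
    ev D u (fun γ => u γ • d) = d := by
  rw [← ev_subst_diagonal D u u fun _ => d]
  have h1 : ev D (subst u (diagonal u)) (fun _ => d) = ev D u fun _ => d := by
    refine hφ.ev_congr hD (fun γ γ' => ?_) _
    rw [subst_diagonal_apply, map_mul, hu]
    split_ifs <;> simp
  have h2 : ev D u (fun _ => d) = (∑' γ, u γ) • d := by
    have h3 := ev_subst D u (fun _ => point ()) fun _ => d
    have h4 : subst u (fun _ => point ()) = (∑' γ, u γ) • point () := by
      ext x
      rw [subst_apply, ConvFam.smul_apply, (summable u.2).tsum_mul_right]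
    rw [h4, ev_smul] at h3
    simpa only [ev_point] using h3.symm
  rw [h1, h2, ← one_smul R d, smul_smul, mul_one]
  refine hφ.smul_congr hD (fun γ => ?_) d
  rw [hφ.apply_tsum u γ γ fun γ' h => by rw [hu, if_neg h.symm], hu, if_pos rfl, map_one]

theorem eq_of_unit_smul_eq (hφ : IsProductReduction H φ) (hD : D.IsAnnihilated H)
    (hu : ∀ γ γ', φ γ' (u γ) = if γ' = γ then 1 else 0) {d d' : D.A}
    (h : ∀ γ, u γ • d = u γ • d') : d = d' := by
  rw [← hφ.ev_unit_smul hD hu d, ← hφ.ev_unit_smul hD hu d']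
  simp only [h]

/-- The `γ`-component of an infinite linear combination of homogeneous elements is a finite sum. -/
theorem unit_smul_ev (hφ : IsProductReduction H φ) (hD : D.IsAnnihilated H)
    (hu : ∀ γ γ', φ γ' (u γ) = if γ' = γ then 1 else 0) {c : X → Γ} {d : X → D.A}
    (hd : ∀ x, u (c x) • d x = d x) (a : ConvFam R X) (γ : Γ) (F : Finset X)
    (hF : ∀ x ∈ F, c x = γ) (hF' : ∀ x, c x = γ → φ γ (a x) ≠ 0 → x ∈ F) :
    u γ • ev D a d = ∑ x ∈ F, a x • d x := by
  classical
  -- Since `u (c x)` fixes `d x`, it may be absorbed into the coefficient, which then vanishes in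
  -- every factor but `c x`. Both sides are afterwards compared factor by factor.
  have hdiag (b : ConvFam R X) : ev D b d = ev D (subst b (diagonal fun x => u (c x))) d := by
    rw [ev_subst_diagonal]
    simp only [hd]
  have hsum : ∑ x ∈ F, a x • d x = ev D (∑ x ∈ F, a x • point x) d := by
    change _ = evₗ D d _
    rw [map_sum]
    refine Finset.sum_congr rfl fun x _ => ?_
    rw [map_smul]
    change _ = a x • ev D (point x) d
    rw [ev_point]
  have hcoef (x : X) : (∑ y ∈ F, a y • point y : ConvFam R X) x = if x ∈ F then a x else 0 := by
    rw [ConvFam.sum_apply]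
    simp only [ConvFam.smul_apply, point_apply, mul_ite, mul_one, mul_zero]
    rw [Finset.sum_ite_eq]
  rw [hsum, ← ev_smul, hdiag, hdiag (∑ x ∈ F, a x • point x)]
  refine hφ.ev_congr hD (fun x γ' => ?_) d
  rw [subst_diagonal_apply, subst_diagonal_apply, hcoef, map_mul, map_mul, hu,
    ConvFam.smul_apply, map_mul, hu]
  by_cases h1 : γ' = c x
  · subst h1
    by_cases h2 : x ∈ F
    · simp [h2, hF x h2]
    · by_cases h3 : c x = γ
      · subst h3
        have : φ (c x) (a x) = 0 := by
          by_contra h4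
          exact h2 (hF' x rfl h4)
        simp [this, h2]
      · simp [h2, h3]
  · simp [h1]

/-- The `γ`-component of a contramodule annihilated by `H`. -/
noncomputable def component (hφ : IsProductReduction H φ) (hD : D.IsAnnihilated H)
    (hu : ∀ γ γ', φ γ' (u γ) = if γ' = γ then 1 else 0) (γ : Γ) : Submodule R D.A where
  carrier := {d | u γ • d = d}
  add_mem' ha hb := (smul_add _ _ _).trans (congrArg₂ (· + ·) ha hb)
  zero_mem' := smul_zero _
  smul_mem' r d hd := by
    change u γ • r • d = r • d
    change u γ • d = d at hd
    rw [← hd, smul_smul, smul_smul, smul_smul]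
    refine hφ.smul_congr hD (fun γ' => ?_) d
    simp only [map_mul, hu]
    split_ifs <;> simp

theorem mem_component (hφ : IsProductReduction H φ) (hD : D.IsAnnihilated H)
    (hu : ∀ γ γ', φ γ' (u γ) = if γ' = γ then 1 else 0) {γ : Γ} {d : D.A} :
    d ∈ hφ.component hD hu γ ↔ u γ • d = d := Iff.rfl

theorem unit_smul_mem_component (hφ : IsProductReduction H φ) (hD : D.IsAnnihilated H)
    (hu : ∀ γ γ', φ γ' (u γ) = if γ' = γ then 1 else 0) (γ : Γ) (d : D.A) :
    u γ • d ∈ hφ.component hD hu γ := by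
  rw [mem_component, smul_smul]
  refine hφ.smul_congr hD (fun γ' => ?_) d
  rw [map_mul, hu]
  split_ifs <;> simp

/-- `R` acts on the component through `S γ`: `r * u γ` and `s * u γ` agree in every factor. -/
theorem smul_congr_component (hφ : IsProductReduction H φ) (hD : D.IsAnnihilated H)
    (hu : ∀ γ γ', φ γ' (u γ) = if γ' = γ then 1 else 0) {γ : Γ} {r s : R} (h : φ γ r = φ γ s)
    {d : D.A} (hd : d ∈ hφ.component hD hu γ) : r • d = s • d := by
  rw [mem_component] at hd
  rw [← hd, smul_smul, smul_smul]
  refine hφ.smul_congr hD (fun γ' => ?_) d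
  rw [map_mul, map_mul, hu]
  split_ifs with h'
  · subst h'
    rw [h]
  · simp

theorem isSemisimpleModule_component (hφ : IsProductReduction H φ) (hD : D.IsAnnihilated H)
    (hu : ∀ γ γ', φ γ' (u γ) = if γ' = γ then 1 else 0) (γ : Γ) [IsSemisimpleRing (S γ)] :
    IsSemisimpleModule R (hφ.component hD hu γ) := by
  have ht : Module.IsTorsionBySet R (hφ.component hD hu γ) (RingHom.ker (φ γ)) := by
    rintro d ⟨r, hr⟩
    apply Subtype.ext
    change r • (d : D.A) = 0
    rw [hφ.smul_congr_component hD hu (s := 0) ((RingHom.mem_ker.1 hr).trans (map_zero _).symm) d.2,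
      zero_smul]
  have : IsSemisimpleRing (R ⧸ RingHom.ker (φ γ)) :=
    (RingHom.quotientKerEquivOfSurjective (hφ.surjective γ)).symm.isSemisimpleRing
  let := ht.module
  exact ht.isSemisimpleModule_iff.1 inferInstance

/-- Every element of a component has the same annihilator as an idempotent of that component. -/
theorem exists_idempotent_of_mem_component (hφ : IsProductReduction H φ)
    (hnil : IsTopLeftTNilpotent H) (hD : D.IsAnnihilated H)
    (hu : ∀ γ γ', φ γ' (u γ) = if γ' = γ then 1 else 0) (γ : Γ) [IsSemisimpleRing (S γ)]
    {m : D.A} (hm : m ∈ hφ.component hD hu γ) :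
    ∃ e : R, IsIdempotentElem e ∧ e • m = m ∧ (∀ γ', γ' ≠ γ → φ γ' e = 0) ∧
      ∀ t : R, t • m = 0 → φ γ (t * e) = 0 := by
  -- The annihilator of `m` has image `S γ · g` with `g` idempotent. The required `e` lifts `1 - g`
  -- in the factor `γ` and `0` elsewhere: it acts on `m` as `1 - t` for some `t` killing `m`, and
  -- `g(1 - g) = 0`.
  let J : Ideal R := LinearMap.ker (LinearMap.toSpanSingleton R D.A m)
  have hJ : ∀ t, t ∈ J ↔ t • m = 0 := fun t => Iff.rfl
  obtain ⟨g, hg, hJg⟩ := IsSemisimpleRing.ideal_eq_span_idempotent (J.map (φ γ))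
  obtain ⟨a, ha⟩ := hφ.exists_apply_eq (Pi.single γ (1 - g))
  have haa : a * a - a ∈ H := (hφ.mem_iff _).2 fun γ' => by
    rw [map_sub, map_mul, ha]
    by_cases h : γ' = γ
    · subst h
      rw [Pi.single_eq_same, hg.one_sub.eq, sub_self]
    · rw [Pi.single_eq_of_ne h, mul_zero, sub_zero]
  obtain ⟨e, he, hea⟩ := exists_isIdempotentElem_sub_mem hφ.isClosed hnil haa
  have hφe : ∀ γ', φ γ' e = Pi.single (M := S) γ (1 - g) γ' := fun γ' => by
    rw [← ha, ← sub_eq_zero, ← map_sub]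
    exact (hφ.mem_iff _).1 hea γ'
  refine ⟨e, he, ?_, fun γ' h => by rw [hφe, Pi.single_eq_of_ne h], fun t ht => ?_⟩
  · have hgm : g ∈ J.map (φ γ) := hJg ▸ Ideal.mem_span_singleton_self g
    obtain ⟨t, ht, htg⟩ := (Ideal.mem_map_iff_of_surjective _ (hφ.surjective γ)).1 hgm
    have h1 : φ γ e = φ γ (1 - t) := by
      rw [hφe, Pi.single_eq_same, map_sub, map_one, htg]
    rw [hφ.smul_congr_component hD hu h1 hm, sub_smul, one_smul, (hJ t).1 ht, sub_zero]
  · have htm : φ γ t ∈ J.map (φ γ) := Ideal.mem_map_of_mem _ ht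
    rw [hJg, Ideal.mem_span_singleton'] at htm
    obtain ⟨c, hc⟩ := htm
    rw [map_mul, ← hc, hφe, Pi.single_eq_same, mul_assoc, mul_sub, mul_one, hg.eq, sub_self,
      mul_zero]

/-- A component is a direct sum of cyclic modules. -/
theorem exists_generators_component (hφ : IsProductReduction H φ) (hD : D.IsAnnihilated H)
    (hu : ∀ γ γ', φ γ' (u γ) = if γ' = γ then 1 else 0) (γ : Γ) [IsSemisimpleRing (S γ)] :
    ∃ (ι : Type u) (m : ι → D.A), (∀ i, m i ∈ hφ.component hD hu γ) ∧
      (∀ d ∈ hφ.component hD hu γ, d ∈ Submodule.span R (Set.range m)) ∧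
      ∀ (F : Finset ι) (t : ι → R), ∑ i ∈ F, t i • m i = 0 → ∀ i ∈ F, t i • m i = 0 := by
  have := hφ.isSemisimpleModule_component hD hu γ
  obtain ⟨T, hind, hsup, hsimple⟩ :=
    IsSemisimpleModule.exists_sSupIndep_sSup_simples_eq_top R (hφ.component hD hu γ)
  have hgen : ∀ N : T, ∃ m, N.1 = Submodule.span R {m} := fun N => by
    have hN := isSimpleModule_iff_isAtom.1 (hsimple N N.2)
    obtain ⟨m, hmN, hm0⟩ := (Submodule.ne_bot_iff _).1 hN.ne_bot
    refine ⟨m, ((hN.le_iff_eq ?_).1 ((Submodule.span_singleton_le_iff_mem m _).2 hmN)).symm⟩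
    rwa [Ne, Submodule.span_singleton_eq_bot]
  choose m hm using hgen
  refine ⟨T, fun N => m N, fun N => (m N).2, fun d hd => ?_, fun F t h N hN => ?_⟩
  · have h1 : (⟨d, hd⟩ : hφ.component hD hu γ) ∈ Submodule.span R (Set.range m) := by
      have h2 : sSup T ≤ Submodule.span R (Set.range m) := sSup_le fun N hN => by
        have h3 : N = Submodule.span R {m ⟨N, hN⟩} := hm ⟨N, hN⟩
        rw [h3, Submodule.span_singleton_le_iff_mem]
        exact Submodule.subset_span ⟨_, rfl⟩
      rw [hsup] at h2
      exact h2 trivial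
    have h4 := Submodule.mem_map_of_mem (f := (hφ.component hD hu γ).subtype) h1
    rw [Submodule.map_span, ← Set.range_comp] at h4
    exact h4
  · classical
    have h1 : ∑ N ∈ F, t N • m N = 0 := by
      apply Subtype.ext
      simpa using h
    rw [sSupIndep_iff] at hind
    have hmem : ∀ N : T, t N • m N ∈ N.1 := fun N =>
      N.1.smul_mem _ (hm N ▸ Submodule.mem_span_singleton_self (m N))
    have h2 : t N • m N = 0 := by
      refine Submodule.disjoint_def.1 (hind N) _ (hmem N) ?_
      rw [← Finset.add_sum_erase _ _ hN] at h1
      rw [eq_neg_of_add_eq_zero_left h1]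
      refine Submodule.neg_mem _ (Submodule.sum_mem _ fun N' hN' => ?_)
      exact Submodule.mem_iSup_of_mem N' (Submodule.mem_iSup_of_mem (Finset.ne_of_mem_erase hN')
        (hmem N'))
    simpa using congrArg Subtype.val h2

end Unit

end IsProductReduction

end Product

/-! ### Existence of projective covers -/

section Main

open ConvFam Contramodule

set_option linter.unusedSectionVars false

variable {R : Type u} [Ring R] [UniformSpace R] [IsUniformAddGroup R] [IsTopologicalRing R]
  [IsLinearTopology Rᵐᵒᵖ R] [CompleteSpace R] [T2Space R] {H : Ideal R} [H.IsTwoSided]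

namespace IsProductReduction

variable {Γ : Type u} {S : Γ → Type w} [∀ γ, Ring (S γ)] [∀ γ, IsSemisimpleRing (S γ)]
  {φ : ∀ γ, R →+* S γ}

/-- A contramodule annihilated by `H` is the reduction of a coproduct of contramodules `R e_x`. -/
theorem exists_basis (hφ : IsProductReduction H φ) (hnil : IsTopLeftTNilpotent H)
    {D : Contramodule R} (hD : D.IsAnnihilated H) :
    ∃ (X : Type u) (e : X → R) (d : X → D.A), (∀ x, IsIdempotentElem (e x)) ∧
      (∀ x, e x • d x = d x) ∧ (∀ m, ∃ a : ConvFam R X, ev D a d = m) ∧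
      ∀ a : ConvFam R X, (∀ x, a x * e x = a x) → ev D a d = 0 → ∀ x, a x ∈ H := by
  classical
  obtain ⟨u, hu⟩ := hφ.exists_unit
  have hu : ∀ γ γ', φ γ' (u γ) = if γ' = γ then 1 else 0 := fun γ γ' => by
    rw [hu]
  choose ι m hm hspan hindep using hφ.exists_generators_component hD hu
  choose e he hem heγ het using fun γ (i : ι γ) =>
    hφ.exists_idempotent_of_mem_component hnil hD hu γ (hm γ i)
  let X : Type u := Σ γ, ι γ
  have hd : ∀ x : X, u x.1 • m x.1 x.2 = m x.1 x.2 := fun x => hm x.1 x.2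
  refine ⟨X, fun x => e x.1 x.2, fun x => m x.1 x.2, fun x => he x.1 x.2, fun x => hem x.1 x.2,
    fun z => ?_, fun a hae ha => ?_⟩
  -- Each component of `z` is a finite combination of generators. Placing its coefficients in the
  -- factor `γ` alone leaves finitely many nonzero entries per factor, so they lift to one
  -- convergent family.
  · choose t ht using fun γ => (Finsupp.mem_span_range_iff_exists_finsupp).1
      (hspan γ _ (hφ.unit_smul_mem_component hD hu γ z))
    obtain ⟨a, ha⟩ := hφ.lift X
      (fun x γ => if γ = x.1 then φ γ (t x.1 x.2) else 0) fun γ => by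
        refine ((t γ).support.finite_toSet.image fun i => (⟨γ, i⟩ : X)).subset ?_
        rintro ⟨γ', i⟩ h
        by_cases hγ : γ = γ'
        · subst hγ
          refine ⟨i, ?_, rfl⟩
          simp only [Finset.mem_coe, Finsupp.mem_support_iff]
          intro h0
          apply h
          simp [h0]
        · exact (h (if_neg hγ)).elim
    refine ⟨a, hφ.eq_of_unit_smul_eq hD hu fun γ => ?_⟩
    rw [hφ.unit_smul_ev hD hu hd a γ ((t γ).support.map (Function.Embedding.sigmaMk γ)), ← ht γ,
      Finsupp.sum, Finset.sum_map]
    · refine Finset.sum_congr rfl fun i _ => ?_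
      refine hφ.smul_congr_component hD hu ?_ (hm γ i)
      rw [ha]
      exact if_pos rfl
    · intro x hx
      obtain ⟨i, _, rfl⟩ := Finset.mem_map.1 hx
      rfl
    · rintro ⟨γ', i⟩ rfl h
      refine Finset.mem_map.2 ⟨i, Finsupp.mem_support_iff.2 fun h0 => h ?_, rfl⟩
      rw [ha]
      simp [h0]
  · rintro ⟨γ, i⟩
    refine (hφ.mem_iff _).2 fun γ' => ?_
    by_cases hγ : γ' = γ
    · subst hγ
      -- The `γ'`-component of the vanishing combination is a finite sum, so each of its terms
      -- vanishes. The annihilator property of `e` then gives `φ γ' (a * e) = 0`, while `a * e = a`.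
      by_contra hne
      have hfin : {j : ι γ' | φ γ' (a ⟨γ', j⟩) ≠ 0}.Finite :=
        (hφ.finite_support a γ').preimage (sigma_mk_injective.injOn)
      have hsum := hφ.unit_smul_ev hD hu hd a γ'
        (hfin.toFinset.map (Function.Embedding.sigmaMk γ')) (fun x hx => by
          obtain ⟨j, _, rfl⟩ := Finset.mem_map.1 hx
          rfl) (by
          rintro ⟨γ'', j⟩ rfl h
          exact Finset.mem_map.2 ⟨j, hfin.mem_toFinset.2 h, rfl⟩)
      rw [ha, smul_zero, Finset.sum_map] at hsum
      have h0 := hindep γ' hfin.toFinset (fun j => a ⟨γ', j⟩) hsum.symm i (hfin.mem_toFinset.2 hne)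
      have h1 := het γ' i _ h0
      rw [hae ⟨γ', i⟩] at h1
      exact hne h1
    · rw [← hae, map_mul, heγ γ i γ' hγ, mul_zero]

theorem exists_isProjectiveCover (hφ : IsProductReduction H φ) (hnil : IsTopLeftTNilpotent H)
    (C : Contramodule R) : ∃ (P : Contramodule R) (p : P ⟶ C), IsProjectiveCover p := by
  have hD : (reduction hφ.isClosed C).IsAnnihilated H := fun h hh => by
    rw [act_eq_ev]
    exact ev_reduction_eq_zero hφ.isClosed hh _
  obtain ⟨X, e, d, he, hd, hspan, hindep⟩ := hφ.exists_basis hnil hD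
  exact exists_isProjectiveCover_of_basis hφ.isClosed hnil C he d hd hspan hindep

end IsProductReduction

/-- Reindexing of the factors along an equivalence. -/
theorem IsProductReduction.reindex {Γ : Type v} {S : Γ → Type w} [∀ γ, Ring (S γ)]
    {φ : ∀ γ, R →+* S γ} (hφ : IsProductReduction H φ) {Δ : Type*} (f : Γ ≃ Δ) :
    IsProductReduction H (S := fun δ => S (f.symm δ)) fun δ => φ (f.symm δ) where
  isOpen_ker δ := hφ.isOpen_ker _
  mem_iff r := (hφ.mem_iff r).trans f.symm.surjective.forall
  lift X s hs := by
    let s' : X → ∀ γ, S γ := fun x => (Equiv.piCongrLeft' S f).symm (s x)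
    have hs' : ∀ x δ, s' x (f.symm δ) = s x δ := fun x δ =>
      congr_fun ((Equiv.piCongrLeft' S f).apply_symm_apply (s x)) δ
    obtain ⟨a, ha⟩ := hφ.lift X s' fun γ => by
      obtain ⟨δ, rfl⟩ := f.symm.surjective γ
      simp only [hs']
      exact hs δ
    exact ⟨a, fun x δ => by rw [ha, hs']⟩

/-- Convergence to zero in a product of discrete rings means finite support in each factor. Such a
family is carried to `R ⧸ H` by the inverse homeomorphism and lifted to `R` by strong closedness. -/
theorem isProductReduction_of_homeomorph (hclosed : IsStronglyClosed H.toAddSubgroup)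
    {Γ : Type v} {S : Γ → Type w} [∀ γ, Ring (S γ)]
    [∀ γ, TopologicalSpace (S γ)] [∀ γ, DiscreteTopology (S γ)]
    (e : (R ⧸ H) ≃+* (∀ γ, S γ)) (he : IsHomeomorph e) :
    IsProductReduction H fun γ =>
      ((Pi.evalRingHom S γ).comp e.toRingHom).comp (Ideal.Quotient.mk H) where
  isOpen_ker γ := by
    have hc : Continuous fun r : R => e (Ideal.Quotient.mk H r) γ :=
      (continuous_apply γ).comp (he.continuous.comp continuous_quot_mk)
    exact (isOpen_discrete {(0 : S γ)}).preimage hc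
  mem_iff r := by
    rw [← Ideal.Quotient.eq_zero_iff_mem, ← map_eq_zero_iff e e.injective, funext_iff]
    rfl
  lift X s hs := by
    have hlim : Tendsto (fun x => e.symm (s x)) cofinite (𝓝 0) := by
      have h1 : Tendsto s cofinite (𝓝 0) := by
        rw [tendsto_pi_nhds]
        intro γ
        rw [nhds_discrete, tendsto_pure]
        exact hs γ
      have h2 : Continuous e.symm := (he.homeomorph e).symm.continuous.congr fun y => by
        apply e.injective
        rw [e.apply_symm_apply]
        exact (he.homeomorph e).apply_symm_apply y
      have h3 := (h2.tendsto 0).comp h1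
      rwa [map_zero] at h3
    obtain ⟨a, ha, has⟩ := hclosed.lift X (fun x => e.symm (s x)) hlim
    refine ⟨⟨a, ha⟩, fun x γ => ?_⟩
    change e (Ideal.Quotient.mk H (a x)) γ = s x γ
    rw [show Ideal.Quotient.mk H (a x) = e.symm (s x) from has x, e.apply_symm_apply]

/-- Nontrivial factors of a quotient of `R` are indexed by a small type. -/
theorem small_of_ringEquiv_pi {Q : Type u} [Ring Q] {Γ : Type v} {S : Γ → Type w}
    [∀ γ, Ring (S γ)] [∀ γ, Nontrivial (S γ)] (e : Q ≃+* (∀ γ, S γ)) : Small.{u} Γ := by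
  classical
  refine small_of_injective (f := fun γ => e.symm (Pi.single γ 1)) fun γ γ' h => ?_
  by_contra hne
  have h1 := congr_fun (e.symm.injective h) γ
  rw [Pi.single_eq_same, Pi.single_eq_of_ne hne] at h1
  exact one_ne_zero h1

end Main

theorem theorem9p4 {R : Type u} [Ring R] [UniformSpace R] [IsUniformAddGroup R]
    [IsTopologicalRing R] [IsLinearTopology Rᵐᵒᵖ R] [CompleteSpace R] [T2Space R]
    (H : Ideal R) [H.IsTwoSided]
    (hclosed : IsStronglyClosed H.toAddSubgroup)
    (hnil : IsTopLeftTNilpotent H)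
    {Γ : Type v} (S : Γ → Type w) [∀ γ, Ring (S γ)]
    [∀ γ, IsSimpleRing (S γ)] [∀ γ, IsArtinianRing (S γ)]
    [∀ γ, TopologicalSpace (S γ)] [∀ γ, DiscreteTopology (S γ)]
    (e : (R ⧸ H) ≃+* (∀ γ, S γ)) (he : IsHomeomorph e)
    (C : Contramodule R) :
    ∃ (P : Contramodule R) (p : P ⟶ C), IsProjectiveCover p := by
  have hS : ∀ γ, IsSemisimpleRing (S γ) := fun γ =>
    (isSimpleRing_isArtinianRing_iff.1 ⟨inferInstance, inferInstance⟩).1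
  -- The factors are reindexed by a type in `Type u`, because `Γ` enters the index sets of the
  -- coproducts and lifted families.
  have := small_of_ringEquiv_pi e
  exact ((isProductReduction_of_homeomorph hclosed e he).reindex
    (equivShrink.{u} Γ)).exists_isProjectiveCover hnil C
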